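/- Conventions. An \emph{interior algebra} is a Boolean algebra $B$ with a map $g\colon B\to B$ satisfying $g(1)=1$, $g(a\cdot b)=g(a)\cdot g(b)$, $g(a)\le a$ and $g(g(a))=g(a)$; homomorphisms are Boolean homomorphisms commuting with $g$. For a Heyting algebra $L$ let $\mathrm{Fr}(L)$ be its free Boolean extension, i.e. the Boolean subalgebra of the power set of the set of prime ideals of $L$ generated by the image of the Stone embedding; $L$ is regarded as a bounded sublattice of $\mathrm{Fr}(L)$. Let $\mathcal B(L)=\langle \mathrm{Fr}(L),g_L\rangle$ be the interior algebra with $$g_L\big((-u_1+v_1)\cdots(-u_n+v_n)\big)=(u_1\Rightarrow v_1)\cdots(u_n\Rightarrow v_n)\qquad(u_i,v_i\in L),$$ and for a homomorphism $h\colon L\to M$ of Heyting algebras let $\mathcal B(h)\colon\mathcal B(L)\to\mathcal B(M)$ be the unique homomorphism of interior algebras extending $h$. For a variety $\mathbf V$ of Heyting algebras let $\rho^*(\mathbf V)$ be the variety of interior algebras generated by $\{\mathcal B(L): L\in\mathbf V\}$. For a variety $\mathbf W$ (of Heyting algebras or of interior algebras), $A\in\mathbf W$ is \emph{finitely presented in}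 $\mathbf W$ if it is presented, relative to $\mathbf W$, by finitely many generators and finitely many relations; $A\in\mathbf W$ is \emph{projective in} $\mathbf W$ if every homomorphism $A\to C$ lifts along every surjective homomorphism $D\to C$ with $C,D\in\mathbf W$. If $A$ is finitely presented in $\mathbf W$, a \emph{unifier} of $A$ in $\mathbf W$ is a pair $\langle u,P\rangle$ where $P\in\mathbf W$ is finitely presented and projective in $\mathbf W$ and $u\colon A\to P$ is a homomorphism. Theorem. Let $\mathbf V$ be a variety of Heyting algebras. If $L$ is finitely presented in $\mathbf V$ and $\langle u,M\rangle$ is a unifier of $L$ in $\mathbf V$, then $\mathcal B(L)$ is finitely presented in $\rho^*(\mathbf V)$ and $\langle\mathcal B(u),\mathcal B(M)\rangle$ is a unifier of $\mathcal B(L)$ in $\rho^*(\mathbf V)$. In particular, if $M$ is finitely presented and projective in $\mathbf V$, then $\mathcal B(M)$ is finitely presented and projective in $\rho^*(\mathbf V)$. -/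

import Mathlib

universe u v

/-! ### Interior algebras -/

/-- An interior algebra `⟨B, g⟩`: a Boolean algebra with an interior operator `g`. -/
class InteriorAlgebra (B : Type u) extends BooleanAlgebra B where
  g : B → B
  g_top : g ⊤ = ⊤
  g_inf : ∀ a b, g (a ⊓ b) = g a ⊓ g b
  g_le : ∀ a, g a ≤ a
  g_idem : ∀ a, g (g a) = g a

/-- Homomorphisms of interior algebras: Boolean homomorphisms that commute with `g`. -/
structure InteriorHom (A : Type u) (B : Type v) [InteriorAlgebra A] [InteriorAlgebra B] extends
    BoundedLatticeHom A B where
  map_g' : ∀ a, toFun (InteriorAlgebra.g a) = InteriorAlgebra.g (toFun a)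

instance InteriorHom.instFunLike (A : Type u) (B : Type v) [InteriorAlgebra A]
    [InteriorAlgebra B] : FunLike (InteriorHom A B) A B where
  coe f := f.toFun
  coe_injective f f' h := by
    obtain ⟨f, _⟩ := f
    obtain ⟨f', _⟩ := f'
    have : f = f' := DFunLike.coe_injective h
    subst this
    rfl

/-! ### Terms, identities, varieties: Heyting algebras -/

/-- Terms in the language of Heyting algebras over a set `X` of variables. -/
inductive HeytTerm (X : Type) : Type
  | var : X → HeytTerm X
  | bot : HeytTerm X
  | top : HeytTerm X
  | inf : HeytTerm X → HeytTerm X → HeytTerm X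
  | sup : HeytTerm X → HeytTerm X → HeytTerm X
  | imp : HeytTerm X → HeytTerm X → HeytTerm X

/-- The value of a term under an assignment `a` of the variables. -/
def HeytTerm.eval {X : Type} {A : Type u} [HeytingAlgebra A] (a : X → A) : HeytTerm X → A
  | var x => a x
  | bot => ⊥
  | top => ⊤
  | inf s t => s.eval a ⊓ t.eval a
  | sup s t => s.eval a ⊔ t.eval a
  | imp s t => s.eval a ⇨ t.eval a

/-- Classes of Heyting algebras. -/
abbrev HeytClass : Type (u + 1) := ∀ (A : Type u) [HeytingAlgebra A], Prop

namespace HeytClass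

/-- A variety is an equational class: the class of all models of some set of identities. -/
def IsVariety (V : HeytClass.{u}) : Prop :=
  ∃ E : Set (HeytTerm ℕ × HeytTerm ℕ), ∀ (A : Type u) [HeytingAlgebra A],
    V A ↔ ∀ e ∈ E, ∀ a : ℕ → A, e.1.eval a = e.2.eval a

/-- `M` is finitely presented in `V`: it belongs to `V` and is presented in `V` by
finitely many generators and finitely many relations. -/
def IsFinitelyPresented (V : HeytClass.{u}) (M : Type u) [HeytingAlgebra M] : Prop :=
  V M ∧ ∃ (n : ℕ) (R : Set (HeytTerm (Fin n) × HeytTerm (Fin n))) (a : Fin n → M),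
    R.Finite ∧ (∀ r ∈ R, r.1.eval a = r.2.eval a) ∧
      ∀ (B : Type u) [HeytingAlgebra B], V B → ∀ b : Fin n → B,
        (∀ r ∈ R, r.1.eval b = r.2.eval b) → ∃! h : HeytingHom M B, ∀ i, h (a i) = b i

/-- `M` is projective in `V`: it belongs to `V` and homomorphisms out of `M` lift along
surjective homomorphisms of `V`. -/
def IsProjective (V : HeytClass.{u}) (M : Type u) [HeytingAlgebra M] : Prop :=
  V M ∧ ∀ (A C : Type u) [HeytingAlgebra A] [HeytingAlgebra C], V A → V C →
    ∀ f : HeytingHom A C, Function.Surjective f → ∀ h : HeytingHom M C,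
      ∃ k : HeytingHom M A, ∀ x, f (k x) = h x

/-- The pair `⟨u, M⟩`, where `u : L → M` is a homomorphism, is a unifier in `V` of the algebra
`L`, finitely presented in `V`. -/
structure IsUnifier (V : HeytClass.{u}) {L M : Type u} [HeytingAlgebra L] [HeytingAlgebra M]
    (u : HeytingHom L M) : Prop where
  source_finitelyPresented : IsFinitelyPresented V L
  target_finitelyPresented : IsFinitelyPresented V M
  target_projective : IsProjective V M

end HeytClass

/-! ### Terms, identities, varieties: interior algebras -/

/-- Terms in the language of interior algebras over a set `X` of variables. -/
inductive IntTerm (X : Type) : Type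
  | var : X → IntTerm X
  | bot : IntTerm X
  | top : IntTerm X
  | inf : IntTerm X → IntTerm X → IntTerm X
  | sup : IntTerm X → IntTerm X → IntTerm X
  | compl : IntTerm X → IntTerm X
  | g : IntTerm X → IntTerm X

/-- The value of a term under an assignment `a` of the variables. -/
def IntTerm.eval {X : Type} {A : Type u} [InteriorAlgebra A] (a : X → A) : IntTerm X → A
  | var x => a x
  | bot => ⊥
  | top => ⊤
  | inf s t => s.eval a ⊓ t.eval a
  | sup s t => s.eval a ⊔ t.eval a
  | compl s => (s.eval a)ᶜ
  | g s => InteriorAlgebra.g (s.eval a)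

/-- Classes of interior algebras. -/
abbrev IntClass : Type (u + 1) := ∀ (A : Type u) [InteriorAlgebra A], Prop

namespace IntClass

/-- A variety is an equational class: the class of all models of some set of identities. -/
def IsVariety (V : IntClass.{u}) : Prop :=
  ∃ E : Set (IntTerm ℕ × IntTerm ℕ), ∀ (A : Type u) [InteriorAlgebra A],
    V A ↔ ∀ e ∈ E, ∀ a : ℕ → A, e.1.eval a = e.2.eval a

/-- `Eq(K)`, the variety generated by the class `K`: the least variety that contains `K`. -/
def generatedVariety (K : IntClass.{u}) : IntClass.{u} := fun A _ =>
  ∀ W : IntClass.{u}, IsVariety W → (∀ (B : Type u) [InteriorAlgebra B], K B → W B) → W A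

theorem generatedVariety_isVariety (K : IntClass.{u}) : IsVariety (generatedVariety K) := by
  refine ⟨{e | ∀ (B : Type u) [InteriorAlgebra B], K B →
    ∀ b : ℕ → B, e.1.eval b = e.2.eval b}, fun A _ => ⟨fun hA e he a => ?_, fun h W hW hK => ?_⟩⟩
  · exact hA (fun B _ => ∀ b : ℕ → B, e.1.eval b = e.2.eval b)
      ⟨{e}, fun B _ => by simp⟩ (fun B _ hB => he B hB) a
  · obtain ⟨E, hE⟩ := hW
    exact (hE A).2 fun e he => h e fun B _ hB => (hE B).1 (hK B hB) e he

/-- `M` is finitely presented in `V`: it belongs to `V` and is presented in `V` by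
finitely many generators and finitely many relations. -/
def IsFinitelyPresented (V : IntClass.{u}) (M : Type u) [InteriorAlgebra M] : Prop :=
  V M ∧ ∃ (n : ℕ) (R : Set (IntTerm (Fin n) × IntTerm (Fin n))) (a : Fin n → M),
    R.Finite ∧ (∀ r ∈ R, r.1.eval a = r.2.eval a) ∧
      ∀ (B : Type u) [InteriorAlgebra B], V B → ∀ b : Fin n → B,
        (∀ r ∈ R, r.1.eval b = r.2.eval b) → ∃! h : InteriorHom M B, ∀ i, h (a i) = b i

/-- `M` is projective in `V`: it belongs to `V` and homomorphisms out of `M` lift along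
surjective homomorphisms of `V`. -/
def IsProjective (V : IntClass.{u}) (M : Type u) [InteriorAlgebra M] : Prop :=
  V M ∧ ∀ (A C : Type u) [InteriorAlgebra A] [InteriorAlgebra C], V A → V C →
    ∀ f : InteriorHom A C, Function.Surjective f → ∀ h : InteriorHom M C,
      ∃ k : InteriorHom M A, ∀ x, f (k x) = h x

/-- The pair `⟨u, M⟩`, where `u : L → M` is a homomorphism, is a unifier in `V` of the algebra
`L`, finitely presented in `V`. -/
structure IsUnifier (V : IntClass.{u}) {L M : Type u} [InteriorAlgebra L] [InteriorAlgebra M]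
    (u : InteriorHom L M) : Prop where
  source_finitelyPresented : IsFinitelyPresented V L
  target_finitelyPresented : IsFinitelyPresented V M
  target_projective : IsProjective V M

end IntClass

/-! ### The free Boolean extension -/

/-- The prime ideals of `L`. -/
abbrev PrimeIdeals (L : Type u) [DistribLattice L] : Type u :=
  {I : Order.Ideal L // I.IsPrime}

/-- The Stone map of `L` into the power set of its prime ideals. -/
def stoneMap (L : Type u) [DistribLattice L] (a : L) : Set (PrimeIdeals L) := {I | a ∉ I.1}

/-- The free Boolean extension `Fr(L)`: the Boolean subalgebra of the power set of the prime
ideals of `L` generated by the image of the Stone map. -/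
abbrev FreeBool (L : Type u) [DistribLattice L] : Type u :=
  ↥(BooleanSubalgebra.closure (Set.range (stoneMap L)))

namespace FreeBool

section Lattice

variable {L : Type u} [DistribLattice L]

theorem stoneMap_bot [BoundedOrder L] : stoneMap L ⊥ = ⊥ := by
  ext I
  simp [stoneMap]

theorem stoneMap_top [BoundedOrder L] : stoneMap L ⊤ = ⊤ := by
  ext I
  simpa [stoneMap] using Order.Ideal.IsProper.top_notMem I.2.toIsProper

theorem stoneMap_sup (a b : L) : stoneMap L (a ⊔ b) = stoneMap L a ⊔ stoneMap L b := by
  ext I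
  simp only [stoneMap, Set.sup_eq_union, Set.mem_union, Set.mem_ofPred_eq, Order.Ideal.sup_mem_iff]
  tauto

theorem stoneMap_inf (a b : L) : stoneMap L (a ⊓ b) = stoneMap L a ⊓ stoneMap L b := by
  ext I
  simp only [stoneMap, Set.inf_eq_inter, Set.mem_inter_iff, Set.mem_ofPred_eq]
  refine ⟨fun h => ⟨fun ha => h (I.1.lower inf_le_left ha),
    fun hb => h (I.1.lower inf_le_right hb)⟩, fun h hab => ?_⟩
  exact (I.2.mem_or_mem hab).elim h.1 h.2

theorem stoneMap_le_iff {a b : L} : stoneMap L a ≤ stoneMap L b ↔ a ≤ b := by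
  refine ⟨fun h => ?_, fun h I ha hb => ha (I.1.lower h hb)⟩
  by_contra hab
  obtain ⟨J, hJ, hbJ, haJ⟩ := DistribLattice.prime_ideal_of_disjoint_filter_ideal
    (F := Order.PFilter.principal a) (I := Order.Ideal.principal b) (by
      rw [Set.disjoint_left]
      intro x hx hx'
      exact hab (le_trans (by simpa using hx) (by simpa using hx')))
  have h1 : (⟨J, hJ⟩ : PrimeIdeals L) ∈ stoneMap L a :=
    Set.disjoint_left.1 haJ (by simp)
  exact h h1 (hbJ (by simp))

variable [BoundedOrder L]

/-- The embedding of `L` into its free Boolean extension. -/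
def of : BoundedLatticeHom L (FreeBool L) where
  toFun a := ⟨stoneMap L a, BooleanSubalgebra.subset_closure ⟨a, rfl⟩⟩
  map_sup' a b := Subtype.ext (stoneMap_sup a b)
  map_inf' a b := Subtype.ext (stoneMap_inf a b)
  map_top' := Subtype.ext stoneMap_top
  map_bot' := Subtype.ext stoneMap_bot

theorem of_le_of_iff {a b : L} : of a ≤ of b ↔ a ≤ b := stoneMap_le_iff

theorem of_injective : Function.Injective (of : L → FreeBool L) := fun _ _ h =>
  le_antisymm (of_le_of_iff.1 h.le) (of_le_of_iff.1 h.ge)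

/-- The element `(-u₁ + v₁) · … · (-uₙ + vₙ)` of the free Boolean extension, for a finite set
`F = {(u₁, v₁), …, (uₙ, vₙ)}` of pairs of elements of `L`. -/
def cnf (F : Finset (L × L)) : FreeBool L := F.inf fun p => (of p.1)ᶜ ⊔ of p.2

theorem exists_cnf (x : FreeBool L) : ∃ F : Finset (L × L), cnf F = x := by
  classical
  suffices H : ∀ y (hy : y ∈ BooleanSubalgebra.closure (Set.range (stoneMap L))),
      ∃ F : Finset (L × L), cnf F = (⟨y, hy⟩ : FreeBool L)ᶜ by
    obtain ⟨F, hF⟩ := H xᶜ.1 xᶜ.2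
    exact ⟨F, by rw [hF, Subtype.coe_eta, compl_compl]⟩
  intro y hy
  have hsub : IsSublattice (Set.range (stoneMap L)) := by
    refine ⟨?_, ?_⟩
    · rintro _ ⟨a, rfl⟩ _ ⟨b, rfl⟩
      exact ⟨a ⊔ b, stoneMap_sup a b⟩
    · rintro _ ⟨a, rfl⟩ _ ⟨b, rfl⟩
      exact ⟨a ⊓ b, stoneMap_inf a b⟩
  induction y, hy using BooleanSubalgebra.closure_sdiff_sup_induction
    (isSublattice := hsub) (bot_mem := ⟨⊥, stoneMap_bot⟩) (top_mem := ⟨⊤, stoneMap_top⟩) with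
  | sdiff x hx y hy =>
    obtain ⟨a, rfl⟩ := hx
    obtain ⟨b, rfl⟩ := hy
    refine ⟨{(a, b)}, ?_⟩
    have : (⟨stoneMap L a \ stoneMap L b, BooleanSubalgebra.sdiff_mem
      (BooleanSubalgebra.subset_closure ⟨a, rfl⟩)
      (BooleanSubalgebra.subset_closure ⟨b, rfl⟩)⟩ : FreeBool L) = of a \ of b := rfl
    rw [this, cnf, Finset.inf_singleton, sdiff_eq, compl_inf, compl_compl]
  | sup x y hx hy ihx ihy =>
    obtain ⟨F, hF⟩ := ihx
    obtain ⟨G, hG⟩ := ihy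
    refine ⟨F ∪ G, ?_⟩
    rw [cnf, Finset.inf_union]
    change cnf F ⊓ cnf G = _
    rw [hF, hG, ← compl_sup]
    rfl

end Lattice

section Heyting

variable {L : Type u} [HeytingAlgebra L]

theorem of_le_cnf_iff (l : L) (F : Finset (L × L)) :
    of l ≤ cnf F ↔ l ≤ F.inf fun p => p.1 ⇨ p.2 := by
  rw [cnf, Finset.le_inf_iff, Finset.le_inf_iff]
  refine forall₂_congr fun p _ => ?_
  rw [le_himp_iff, ← of_le_of_iff (a := l ⊓ p.1), map_inf, sup_comm, ← himp_eq, le_himp_iff]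

/-- The operator `g_L`: if `x = (-u₁ + v₁) · … · (-uₙ + vₙ)` with `uᵢ, vᵢ ∈ L`, then `g_L x` is
`(u₁ ⇒ v₁) · … · (uₙ ⇒ vₙ)`. By `gL_cnf` it does not depend on the representation. -/
noncomputable def gL (x : FreeBool L) : L :=
  (Classical.choose (exists_cnf x)).inf fun p => p.1 ⇨ p.2

theorem le_gL_iff {l : L} {x : FreeBool L} : l ≤ gL x ↔ of l ≤ x := by
  have h := of_le_cnf_iff l (Classical.choose (exists_cnf x))
  rw [Classical.choose_spec (exists_cnf x)] at h
  exact h.symm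

theorem gL_cnf (F : Finset (L × L)) : gL (cnf F) = F.inf fun p => p.1 ⇨ p.2 :=
  eq_of_forall_le_iff fun l => le_gL_iff.trans (of_le_cnf_iff l F)

theorem gL_of (l : L) : gL (of l) = l :=
  eq_of_forall_le_iff fun _ => le_gL_iff.trans of_le_of_iff

/-- The interior algebra `B(L) = ⟨Fr(L), g_L⟩`. -/
noncomputable instance instInteriorAlgebra : InteriorAlgebra (FreeBool L) where
  g x := of (gL x)
  g_top := by rw [← map_top (of : BoundedLatticeHom L (FreeBool L)), gL_of]
  g_inf x y := by
    rw [← map_inf]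
    congr 1
    exact eq_of_forall_le_iff fun l => by
      rw [le_gL_iff, le_inf_iff, le_inf_iff, le_gL_iff, le_gL_iff]
  g_le x := le_gL_iff.1 le_rfl
  g_idem x := by rw [gL_of]

end Heyting

section Map

variable {L M : Type u}

/-- The inverse image of a prime ideal under a homomorphism. -/
def comapIdeal [DistribLattice L] [BoundedOrder L] [DistribLattice M] [BoundedOrder M]
    (h : BoundedLatticeHom L M) (I : PrimeIdeals M) : PrimeIdeals L :=
  ⟨{ carrier := {a | h a ∈ I.1}
     lower' := fun _ _ hab ha => I.1.lower (OrderHomClass.mono h hab) ha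
     nonempty' := ⟨⊥, by simp⟩
     directed' := fun a ha b hb => ⟨a ⊔ b, by
       rw [Set.mem_ofPred_eq, map_sup]
       exact Order.Ideal.sup_mem ha hb, le_sup_left, le_sup_right⟩ }, by
    refine @Order.Ideal.IsPrime.of_mem_or_mem _ _ _
      (Order.Ideal.isProper_of_notMem (p := ⊤) fun ht => ?_) fun {a b} hab => ?_
    · have ht' : h ⊤ ∈ I.1 := ht
      rw [map_top] at ht'
      exact I.2.toIsProper.top_notMem ht'
    · have hab' : h (a ⊓ b) ∈ I.1 := hab
      rw [map_inf] at hab'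
      exact I.2.mem_or_mem hab'⟩

theorem preimage_mem [DistribLattice L] [BoundedOrder L] [DistribLattice M] [BoundedOrder M]
    (h : BoundedLatticeHom L M) (x : FreeBool L) :
    comapIdeal h ⁻¹' x.1 ∈ BooleanSubalgebra.closure (Set.range (stoneMap M)) := by
  obtain ⟨x, hx⟩ := x
  induction hx using BooleanSubalgebra.closure_bot_sup_induction with
  | mem x hx =>
    obtain ⟨a, rfl⟩ := hx
    exact BooleanSubalgebra.subset_closure ⟨h a, rfl⟩
  | bot => exact BooleanSubalgebra.bot_mem
  | sup x hx y hy ihx ihy => exact BooleanSubalgebra.sup_mem ihx ihy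
  | compl x hx ihx => exact BooleanSubalgebra.compl_mem ihx

/-- The Boolean homomorphism `Fr(L) → Fr(M)` that extends `h : L → M`. -/
def mapBool [DistribLattice L] [BoundedOrder L] [DistribLattice M] [BoundedOrder M]
    (h : BoundedLatticeHom L M) : BoundedLatticeHom (FreeBool L) (FreeBool M) where
  toFun x := ⟨comapIdeal h ⁻¹' x.1, preimage_mem h x⟩
  map_sup' _ _ := rfl
  map_inf' _ _ := rfl
  map_top' := rfl
  map_bot' := rfl

theorem mapBool_of [DistribLattice L] [BoundedOrder L] [DistribLattice M] [BoundedOrder M]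
    (h : BoundedLatticeHom L M) (a : L) : mapBool h (of a) = of (h a) := rfl

variable [HeytingAlgebra L] [HeytingAlgebra M]

theorem gL_mapBool (h : HeytingHom L M) (x : FreeBool L) :
    gL (mapBool (h : BoundedLatticeHom L M) x) = h (gL x) := by
  classical
  obtain ⟨F, rfl⟩ := exists_cnf x
  have : mapBool (h : BoundedLatticeHom L M) (cnf F) =
      cnf (F.image fun p => (h p.1, h p.2)) := by
    rw [cnf, cnf, Finset.inf_image, map_finset_inf]
    refine Finset.inf_congr rfl fun p _ => ?_
    rw [Function.comp_apply, map_sup, map_compl', mapBool_of, mapBool_of]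
    rfl
  rw [this, gL_cnf, gL_cnf, Finset.inf_image, map_finset_inf]
  refine Finset.inf_congr rfl fun p _ => ?_
  simp

/-- The homomorphism `B(h) : B(L) → B(M)`; by `map_of` and `map_unique` it is the unique
homomorphism of interior algebras that extends `h`. -/
noncomputable def map (h : HeytingHom L M) : InteriorHom (FreeBool L) (FreeBool M) where
  toBoundedLatticeHom := mapBool (h : BoundedLatticeHom L M)
  map_g' x := (congrArg of (gL_mapBool h x)).symm

theorem map_of (h : HeytingHom L M) (a : L) : map h (of a) = of (h a) := rfl

theorem map_unique (h : HeytingHom L M) (k : InteriorHom (FreeBool L) (FreeBool M))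
    (hk : ∀ a, k (of a) = of (h a)) : k = map h := by
  refine DFunLike.ext _ _ fun x => ?_
  obtain ⟨F, rfl⟩ := exists_cnf x
  change k.toBoundedLatticeHom (cnf F) = (map h).toBoundedLatticeHom (cnf F)
  rw [cnf, map_finset_inf, map_finset_inf]
  refine Finset.inf_congr rfl fun p _ => ?_
  have h1 : k.toBoundedLatticeHom (of p.1) = (map h).toBoundedLatticeHom (of p.1) := hk p.1
  have h2 : k.toBoundedLatticeHom (of p.2) = (map h).toBoundedLatticeHom (of p.2) := hk p.2
  rw [Function.comp_apply, Function.comp_apply, map_sup, map_sup, map_compl', map_compl', h1, h2]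

end Map

end FreeBool

/-! ### The operator `ρ*` -/

/-- The class `B[V]` of the algebras `B(L)`, `L ∈ V`, up to isomorphism. -/
def imageB (V : HeytClass.{u}) : IntClass.{u} := fun A _ =>
  ∃ (L : Type u) (_ : HeytingAlgebra L), V L ∧
    ∃ f : InteriorHom A (FreeBool L), Function.Bijective f

/-- `ρ*(V) = Eq(B[V])`. -/
def rhoStar (V : HeytClass.{u}) : IntClass.{u} := IntClass.generatedVariety (imageB V)

/-! The construction `B` is left adjoint to the functor sending an interior algebra `A` to its
Heyting algebra of open elements. Homomorphisms `L → OpenElements A` extend uniquely to `B(L) → A`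
(`FreeBool.lift`, `FreeBool.lift_of`, `FreeBool.interiorHom_ext`). The right adjoint preserves
surjections (`OpenElements.map_surjective`) and, by the Gödel translation, carries `ρ*(V)` into `V`
(`HeytClass.IsVariety.openElements`).

Hence lifting problems for `B(M)` in `ρ*(V)` reduce to lifting problems for `M` in `V`, so
projectivity passes to `B(M)`. A finite presentation of `M` becomes one of `B(M)` by translating its
relations and requiring each generator to be open. Being a unifier constrains only the source and
target algebras, so nothing further is needed. -/

/-! ### Homomorphisms of interior algebras -/

namespace InteriorHom

variable {A : Type u} {B : Type v} [InteriorAlgebra A] [InteriorAlgebra B]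

instance instBoundedLatticeHomClass : BoundedLatticeHomClass (InteriorHom A B) A B where
  map_sup f := f.map_sup'
  map_inf f := f.map_inf'
  map_top f := f.map_top'
  map_bot f := f.map_bot'

theorem map_g (f : InteriorHom A B) (a : A) :
    f (InteriorAlgebra.g a) = InteriorAlgebra.g (f a) := f.map_g' a

/-- The composite of two homomorphisms of interior algebras. -/
def comp {C : Type*} [InteriorAlgebra C] (f : InteriorHom B C) (f' : InteriorHom A B) :
    InteriorHom A C where
  toBoundedLatticeHom := f.toBoundedLatticeHom.comp f'.toBoundedLatticeHom
  map_g' a := (congrArg f (f'.map_g a)).trans (f.map_g (f' a))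

end InteriorHom

theorem IntTerm.map_eval {X : Type} {A : Type u} {B : Type v} [InteriorAlgebra A]
    [InteriorAlgebra B] (f : InteriorHom A B) (a : X → A) (t : IntTerm X) :
    f (t.eval a) = t.eval (f ∘ a) := by
  induction t with
  | var x => rfl
  | bot => exact map_bot f
  | top => exact map_top f
  | inf s t hs ht => simp only [eval, map_inf, hs, ht]
  | sup s t hs ht => simp only [eval, map_sup, hs, ht]
  | compl s hs => simp only [eval, map_compl', hs]
  | g s hs => simp only [eval, InteriorHom.map_g, hs]

theorem HeytTerm.map_eval {X : Type} {A : Type u} {B : Type v} [HeytingAlgebra A]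
    [HeytingAlgebra B] (f : HeytingHom A B) (a : X → A) (t : HeytTerm X) :
    f (t.eval a) = t.eval (f ∘ a) := by
  induction t with
  | var x => rfl
  | bot => exact map_bot f
  | top => exact map_top f
  | inf s t hs ht => simp only [eval, map_inf, hs, ht]
  | sup s t hs ht => simp only [eval, map_sup, hs, ht]
  | imp s t hs ht => simp only [eval, map_himp, hs, ht]

/-! ### The Heyting algebra of open elements -/

namespace InteriorAlgebra

variable {A : Type u} [InteriorAlgebra A]

theorem g_mono : Monotone (g : A → A) := fun a b hab => by
  rw [← inf_eq_left, ← g_inf, inf_eq_left.2 hab]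

theorem g_bot : g (⊥ : A) = ⊥ := le_bot_iff.1 (g_le ⊥)

theorem g_sup_of_open {a b : A} (ha : g a = a) (hb : g b = b) : g (a ⊔ b) = a ⊔ b :=
  le_antisymm (g_le _) (sup_le (ha.symm.le.trans (g_mono le_sup_left))
    (hb.symm.le.trans (g_mono le_sup_right)))

theorem g_inf_of_open {a b : A} (ha : g a = a) (hb : g b = b) : g (a ⊓ b) = a ⊓ b := by
  rw [g_inf, ha, hb]

end InteriorAlgebra

/-- The open elements of an interior algebra, i.e. the fixed points of `g`. -/
def OpenElements (A : Type u) [InteriorAlgebra A] : Type u :=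
  {a : A // InteriorAlgebra.g a = a}

namespace OpenElements

open InteriorAlgebra

section Basic

variable {A : Type u} [InteriorAlgebra A]

instance instLattice : Lattice (OpenElements A) :=
  Subtype.lattice (fun _ _ => g_sup_of_open) (fun _ _ => g_inf_of_open)

instance instHeytingAlgebra : HeytingAlgebra (OpenElements A) where
  top := ⟨⊤, g_top⟩
  le_top a := show a.1 ≤ ⊤ from le_top
  bot := ⟨⊥, g_bot⟩
  bot_le a := show ⊥ ≤ a.1 from bot_le
  himp a b := ⟨g (a.1ᶜ ⊔ b.1), g_idem _⟩
  le_himp_iff a b c := by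
    change a.1 ≤ g (b.1ᶜ ⊔ c.1) ↔ a.1 ⊓ b.1 ≤ c.1
    rw [← le_himp_iff, himp_eq, sup_comm]
    exact ⟨fun h => h.trans (g_le _), fun h => a.2.symm.le.trans (g_mono h)⟩
  -- The redundant `⊔ ⊥` makes `himp_bot` hold definitionally.
  compl a := ⟨g (a.1ᶜ ⊔ ⊥), g_idem _⟩
  himp_bot _ := rfl

/-- The inclusion of the open elements. -/
def incl (A : Type u) [InteriorAlgebra A] : BoundedLatticeHom (OpenElements A) A where
  toFun := Subtype.val
  map_sup' _ _ := rfl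
  map_inf' _ _ := rfl
  map_top' := rfl
  map_bot' := rfl

/-- The interior of an element, as an open element. -/
def interior (a : A) : OpenElements A := ⟨g a, g_idem a⟩

theorem interior_coe (a : OpenElements A) : interior a.1 = a := Subtype.ext a.2

end Basic

variable {A : Type u} {B : Type v} [InteriorAlgebra A] [InteriorAlgebra B]

/-- The restriction of a homomorphism of interior algebras to the open elements. -/
def map (f : InteriorHom A B) : HeytingHom (OpenElements A) (OpenElements B) where
  toFun a := ⟨f a.1, by rw [← f.map_g, a.2]⟩
  map_sup' a b := Subtype.ext (map_sup f a.1 b.1)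
  map_inf' a b := Subtype.ext (map_inf f a.1 b.1)
  map_bot' := Subtype.ext (map_bot f)
  map_himp' a b := Subtype.ext (by
    change f (g (a.1ᶜ ⊔ b.1)) = g ((f a.1)ᶜ ⊔ f b.1)
    rw [f.map_g, map_sup, map_compl'])

theorem coe_map (f : InteriorHom A B) (a : OpenElements A) : (map f a).1 = f a.1 := rfl

/-- A preimage of an open element need not be open, but its interior is open and has the same image,
since `f` commutes with `g`. -/
theorem map_surjective {f : InteriorHom A B} (hf : Function.Surjective f) :
    Function.Surjective (map f) := fun b => by
  obtain ⟨a, ha⟩ := hf b.1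
  exact ⟨interior a, Subtype.ext (by rw [coe_map, interior, f.map_g, ha, b.2])⟩

end OpenElements

/-! ### The translation of Heyting terms into terms for interior algebras -/

/-- The Gödel translation of Heyting terms. -/
def HeytTerm.translate {X : Type} : HeytTerm X → IntTerm X
  | var x => .g (.var x)
  | bot => .bot
  | top => .top
  | inf s t => .inf s.translate t.translate
  | sup s t => .sup s.translate t.translate
  | imp s t => .g (.sup (.compl s.translate) t.translate)

/-- Because variables are translated with a `g` in front, the assignment is arbitrary. Thus a
Heyting identity of the open elements amounts to an identity of `A` itself. -/
theorem HeytTerm.eval_translate {X : Type} {A : Type u} [InteriorAlgebra A] (a : X → A)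
    (t : HeytTerm X) :
    t.translate.eval a = (t.eval fun x => OpenElements.interior (a x)).1 := by
  induction t with
  | var x => rfl
  | bot => rfl
  | top => rfl
  | inf s t hs ht => exact congrArg₂ (· ⊓ ·) hs ht
  | sup s t hs ht => exact congrArg₂ (· ⊔ ·) hs ht
  | imp s t hs ht =>
    exact congrArg₂ (fun x y => InteriorAlgebra.g (xᶜ ⊔ y)) hs ht

theorem HeytTerm.eval_translate_coe {X : Type} {A : Type u} [InteriorAlgebra A]
    (a : X → OpenElements A) (t : HeytTerm X) :
    t.translate.eval (fun x => (a x).1) = (t.eval a).1 := by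
  simp only [eval_translate, OpenElements.interior_coe]

/-! ### The universal property of `B(L)` -/

namespace FreeBool

section Boolean

variable {A : Type u} [BooleanAlgebra A]

/-- Complements already exist in `A` and are preserved by `of`, so the same normal form computed in
`A` is a preimage. -/
theorem of_surjective : Function.Surjective (of : A → FreeBool A) := fun x => by
  obtain ⟨F, rfl⟩ := exists_cnf x
  refine ⟨F.inf fun p => p.1ᶜ ⊔ p.2, ?_⟩
  rw [cnf, map_finset_inf]
  refine Finset.inf_congr rfl fun p _ => ?_
  rw [Function.comp_apply, map_sup, map_compl']

/-- A Boolean algebra is isomorphic to its free Boolean extension. -/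
noncomputable def ofEquiv (A : Type u) [BooleanAlgebra A] : A ≃ FreeBool A :=
  Equiv.ofBijective of ⟨of_injective, of_surjective⟩

theorem of_ofEquiv_symm (x : FreeBool A) : of ((ofEquiv A).symm x) = x :=
  (ofEquiv A).apply_symm_apply x

/-- The retraction of the free Boolean extension of a Boolean algebra. -/
noncomputable def retract (A : Type u) [BooleanAlgebra A] : BoundedLatticeHom (FreeBool A) A where
  toFun := (ofEquiv A).symm
  map_sup' x y := of_injective (by simp only [map_sup, of_ofEquiv_symm])
  map_inf' x y := of_injective (by simp only [map_inf, of_ofEquiv_symm])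
  map_top' := of_injective (by simp only [map_top, of_ofEquiv_symm])
  map_bot' := of_injective (by simp only [map_bot, of_ofEquiv_symm])

theorem retract_of (a : A) : retract A (of a) = a := (ofEquiv A).symm_apply_apply a

end Boolean

/-- The extension of a lattice homomorphism into a Boolean algebra to `Fr(L)`. -/
noncomputable def liftBool {L A : Type u} [DistribLattice L] [BoundedOrder L] [BooleanAlgebra A]
    (h : BoundedLatticeHom L A) : BoundedLatticeHom (FreeBool L) A :=
  -- Functoriality gives `Fr(L) → Fr(A)`, and `Fr(A)` collapses to `A` because `A` is Boolean.
  (retract A).comp (mapBool h)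

theorem liftBool_of {L A : Type u} [DistribLattice L] [BoundedOrder L] [BooleanAlgebra A]
    (h : BoundedLatticeHom L A) (l : L) : liftBool h (of l) = h l := retract_of (h l)

variable {L A : Type u} [HeytingAlgebra L] [InteriorAlgebra A]

/-- The identification of `L` with the open elements of `B(L)`. -/
noncomputable def toOpen (L : Type u) [HeytingAlgebra L] :
    HeytingHom L (OpenElements (FreeBool L)) where
  toFun l := ⟨of l, congrArg of (gL_of l)⟩
  map_sup' a b := Subtype.ext (map_sup of a b)
  map_inf' a b := Subtype.ext (map_inf of a b)
  map_bot' := Subtype.ext (map_bot of)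
  map_himp' a b := Subtype.ext (by
    have h := gL_cnf ({(a, b)} : Finset (L × L))
    rw [cnf, Finset.inf_singleton, Finset.inf_singleton] at h
    exact congrArg of h.symm)

theorem toOpen_gL (x : OpenElements (FreeBool L)) : toOpen L (gL x.1) = x := Subtype.ext x.2

/-- The uniqueness half of the adjunction: `L` generates `Fr(L)` already as a Boolean algebra. -/
theorem interiorHom_ext {k k' : InteriorHom (FreeBool L) A} (h : ∀ l, k (of l) = k' (of l)) :
    k = k' := by
  refine DFunLike.ext _ _ fun x => ?_
  obtain ⟨F, rfl⟩ := exists_cnf x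
  rw [cnf, map_finset_inf, map_finset_inf]
  refine Finset.inf_congr rfl fun p _ => ?_
  rw [Function.comp_apply, Function.comp_apply, map_sup, map_sup, map_compl', map_compl', h, h]

/-- The extension of a homomorphism from `L` to the open elements of `A` to `B(L)`. -/
noncomputable def lift (h : HeytingHom L (OpenElements A)) : InteriorHom (FreeBool L) A where
  toBoundedLatticeHom := liftBool ((OpenElements.incl A).comp (h : BoundedLatticeHom L _))
  map_g' x := by
    change liftBool _ (of (gL x)) = InteriorAlgebra.g (liftBool _ x)
    rw [liftBool_of]
    change OpenElements.incl A (h (gL x)) = _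
    -- Implication of open elements is `g (-u + v)`, and `g` preserves finite meets; so the formula
    -- defining `g_L` also computes `g` on the image in `A`.
    have key : ∀ F : Finset (L × L), OpenElements.incl A (h (F.inf fun p => p.1 ⇨ p.2)) =
        InteriorAlgebra.g (F.inf fun p => (h p.1).1ᶜ ⊔ (h p.2).1) := fun F => by
      classical
      induction F using Finset.induction_on with
      | empty => simp [InteriorAlgebra.g_top]
      | insert p F _ ih =>
        rw [Finset.inf_insert, Finset.inf_insert, map_inf, map_inf, ih, InteriorAlgebra.g_inf,
          map_himp]
        rfl
    obtain ⟨F, rfl⟩ := exists_cnf x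
    rw [gL_cnf, key, cnf, map_finset_inf]
    congr 1
    refine Finset.inf_congr rfl fun p _ => ?_
    rw [Function.comp_apply, map_sup, map_compl', liftBool_of, liftBool_of]
    rfl

theorem lift_of (h : HeytingHom L (OpenElements A)) (l : L) : lift h (of l) = (h l).1 :=
  liftBool_of _ l

end FreeBool

/-! ### `ρ*(V)` -/

theorem rhoStar_freeBool {V : HeytClass.{u}} {L : Type u} [HeytingAlgebra L] (hL : V L) :
    rhoStar V (FreeBool L) := fun _ _ hW =>
  hW _ ⟨L, inferInstance, hL, ⟨BoundedLatticeHom.id _, fun _ => rfl⟩, Function.bijective_id⟩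

/-- The translation of an identity of `V` need only be checked on the generators `B(L)` of `ρ*(V)`,
and the open elements of `B(L)` are just `L`. -/
theorem HeytClass.IsVariety.openElements {V : HeytClass.{u}} (hV : IsVariety V) {A : Type u}
    [InteriorAlgebra A] (hA : rhoStar V A) : V (OpenElements A) := by
  obtain ⟨E, hE⟩ := hV
  refine (hE _).2 fun e he a => Subtype.ext ?_
  rw [← HeytTerm.eval_translate_coe, ← HeytTerm.eval_translate_coe]
  refine hA (fun B _ => ∀ b : ℕ → B, e.1.translate.eval b = e.2.translate.eval b)
    ⟨{(e.1.translate, e.2.translate)}, fun B _ => by simp⟩ ?_ _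
  rintro B _ ⟨L, _, hL, f, hf⟩ b
  apply hf.1
  rw [IntTerm.map_eval, IntTerm.map_eval, HeytTerm.eval_translate, HeytTerm.eval_translate]
  -- The interiors of the assigned values come from an assignment in `L`, where the identity holds
  -- by hypothesis.
  have hx : (fun x => OpenElements.interior ((f ∘ b) x)) =
      FreeBool.toOpen L ∘ fun x => FreeBool.gL (OpenElements.interior ((f ∘ b) x)).1 :=
    funext fun x => (FreeBool.toOpen_gL _).symm
  rw [hx, ← HeytTerm.map_eval, ← HeytTerm.map_eval, (hE L).1 hL e he]

theorem HeytClass.IsFinitelyPresented.freeBool {V : HeytClass.{u}} (hV : IsVariety V)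
    {M : Type u} [HeytingAlgebra M] (hM : IsFinitelyPresented V M) :
    IntClass.IsFinitelyPresented (rhoStar V) (FreeBool M) := by
  obtain ⟨hVM, n, R, a, hR, ha, huniv⟩ := hM
  refine ⟨rhoStar_freeBool hVM, n,
    (fun r => (r.1.translate, r.2.translate)) '' R ∪
      Set.range fun i => (IntTerm.g (.var i), IntTerm.var i),
    fun i => FreeBool.of (a i), (hR.image _).union (Set.finite_range _), ?_, ?_⟩
  · rintro _ (⟨r, hr, rfl⟩ | ⟨i, rfl⟩)
    · change r.1.translate.eval (fun i => (FreeBool.toOpen M (a i)).1) =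
        r.2.translate.eval (fun i => (FreeBool.toOpen M (a i)).1)
      rw [HeytTerm.eval_translate_coe, HeytTerm.eval_translate_coe]
      have h := congrArg (FreeBool.toOpen M) (ha r hr)
      rw [HeytTerm.map_eval, HeytTerm.map_eval] at h
      exact congrArg Subtype.val h
    · exact (FreeBool.toOpen M (a i)).2
  · intro B _ hB b hb
    -- The added relations `g xᵢ = xᵢ` are what make `b` an assignment in the open elements.
    let b' : Fin n → OpenElements B := fun i => ⟨b i, hb _ (.inr ⟨i, rfl⟩)⟩
    obtain ⟨h, hh, hunique⟩ := huniv (OpenElements B) (hV.openElements hB) b' fun r hr =>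
      Subtype.ext (by
        rw [← HeytTerm.eval_translate_coe, ← HeytTerm.eval_translate_coe]
        exact hb _ (.inl ⟨r, hr, rfl⟩))
    refine ⟨FreeBool.lift h, fun i => by rw [FreeBool.lift_of, hh], fun k hk => ?_⟩
    -- The adjoint transpose of `k` solves the same problem in `V`, so it equals `h`.
    have hk' := hunique ((OpenElements.map k).comp (FreeBool.toOpen M)) fun i =>
      Subtype.ext (hk i)
    refine FreeBool.interiorHom_ext fun l => ?_
    rw [FreeBool.lift_of, ← hk']
    rfl

theorem HeytClass.IsProjective.freeBool {V : HeytClass.{u}} (hV : IsVariety V)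
    {M : Type u} [HeytingAlgebra M] (hM : IsProjective V M) :
    IntClass.IsProjective (rhoStar V) (FreeBool M) := by
  refine ⟨rhoStar_freeBool hM.1, fun A C _ _ hA hC f hf h => ?_⟩
  -- The lifting problem is transposed to open elements, solved in `V`, and its solution transposed
  -- back by `FreeBool.lift`.
  obtain ⟨k, hk⟩ := hM.2 _ _ (hV.openElements hA) (hV.openElements hC) (OpenElements.map f)
    (OpenElements.map_surjective hf) ((OpenElements.map h).comp (FreeBool.toOpen M))
  have heq : f.comp (FreeBool.lift k) = h := FreeBool.interiorHom_ext fun l => by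
    change f (FreeBool.lift k (FreeBool.of l)) = h (FreeBool.of l)
    rw [FreeBool.lift_of]
    exact congrArg Subtype.val (hk l)
  exact ⟨FreeBool.lift k, fun x => DFunLike.congr_fun heq x⟩

theorem mainTheorem6 (V : HeytClass.{u}) (hV : HeytClass.IsVariety V) :
    (∀ (L M : Type u) [HeytingAlgebra L] [HeytingAlgebra M] (h : HeytingHom L M),
      HeytClass.IsUnifier V h → IntClass.IsUnifier (rhoStar V) (FreeBool.map h)) ∧
    (∀ (M : Type u) [HeytingAlgebra M],
      HeytClass.IsFinitelyPresented V M → HeytClass.IsProjective V M →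
        IntClass.IsFinitelyPresented (rhoStar V) (FreeBool M) ∧
          IntClass.IsProjective (rhoStar V) (FreeBool M)) :=
  ⟨fun _ _ _ _ _ hu => ⟨hu.source_finitelyPresented.freeBool hV,
    hu.target_finitelyPresented.freeBool hV, hu.target_projective.freeBool hV⟩,
    fun _ _ hfp hpr => ⟨hfp.freeBool hV, hpr.freeBool hV⟩⟩
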